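/- \textbf{Proposition.} Let $\mathbf k$ be an algebraically closed field of characteristic zero, and let $\mathcal C$ be a modular tensor category over $\mathbf k$, i.e. a braided fusion category over $\mathbf k$ (semisimple, rigid, $\mathbf k$-linear abelian monoidal, with finite-dimensional Hom spaces, finitely many isomorphism classes of simple objects and $\operatorname{End}(\mathbf 1)=\mathbf k$) with a spherical structure whose $S$-matrix is non-degenerate. Suppose that $\mathcal C$ is odd-dimensional, i.e. its Frobenius--Perron dimension $\operatorname{FPdim}(\mathcal C)=\sum_X \operatorname{FPdim}(X)^2$ (sum over isomorphism classes of simple objects) is an odd integer. Let $\mathcal C=\bigoplus_{g\in U}\mathcal C_g$ be the universal grading of $\mathcal C$, i.e. the faithful grading by a finite group from which every faithful grading by a finite group is obtained through a group homomorphism. Let $\mathcal C_{\mathrm{ad}}$ be the adjoint subcategory, i.e. the fusion subcategory generated by $X\otimes X^*$ for all simple $X$. The rank of a full subcategory of this kind is its number of isomorphism classes of simple objects. Then for every $g\in U$ such that $\mathcal C_g$ contains an invertible object, $$\operatorname{rank}(\mathcal C_g)=\operatorname{rank}(\mathcal C_{\mathrm{ad}}).$$ In particular, all components of the universal grading that contain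 an invertible object have the same rank. -/

import Mathlib

open CategoryTheory CategoryTheory.Limits CategoryTheory.MonoidalCategory

noncomputable section

namespace ModularTensor

open scoped ZeroObject

attribute [local instance] Abelian.hasFiniteBiproducts

universe w v u

/-! ### Simple objects and fusion categories -/

section Simples

variable (C : Type u) [Category.{v} C] [HasZeroMorphisms C]

/-- Isomorphism, as an equivalence relation on the simple objects of `C`. -/
def simpleSetoid : Setoid {X : C // Simple X} where
  r X Y := Nonempty (X.1 ≅ Y.1)
  iseqv := ⟨fun _ => ⟨Iso.refl _⟩, fun ⟨e⟩ => ⟨e.symm⟩, fun ⟨e⟩ ⟨f⟩ => ⟨e.trans f⟩⟩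

/-- The set `𝒪(C)` of isomorphism classes of simple objects of `C`. -/
def Irr : Type u := Quotient (simpleSetoid C)

variable {C}

/-- A chosen simple object in an isomorphism class of simple objects. -/
def Irr.rep (s : Irr C) : C := (Quotient.out (s : Quotient (simpleSetoid C))).1

/-- The rank of a full subcategory `P` of `C`: the number of isomorphism classes of simple
objects of `C` that have a representative in `P`. -/
def rank (P : ObjectProperty C) : ℕ :=
  Set.ncard {s : Irr C | ∃ X : {X : C // Simple X}, Quotient.mk (simpleSetoid C) X = s ∧ P X.1}

end Simples

/-- A `k`-linear abelian rigid monoidal category (with bilinear tensor product) is a fusion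
category if its hom spaces are finite-dimensional, every object is a finite direct sum of
simple objects, there are finitely many isomorphism classes of simple objects, and
`End(𝟙) = k`. -/
class IsFusionCategory (k : Type*) [Field k] (C : Type u) [Category.{v} C] [Abelian C]
    [Linear k C] [MonoidalCategory C] [MonoidalPreadditive C] [MonoidalLinear k C]
    [RigidCategory C] : Prop where
  finiteDimensional_hom : ∀ X Y : C, FiniteDimensional k (X ⟶ Y)
  semisimple : ∀ X : C, ∃ (n : ℕ) (S : Fin n → C),
    (∀ i, Simple (S i)) ∧ Nonempty (X ≅ ⨁ S)
  finite_irr : Finite (Irr C)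
  end_unit : Function.Bijective (fun a : k => a • 𝟙 (𝟙_ C))

/-- The identification of `End(𝟙)` with the ground field. -/
def endUnitScalar (k : Type*) [Field k] {C : Type u} [Category.{v} C] [Abelian C]
    [Linear k C] [MonoidalCategory C] [MonoidalPreadditive C] [MonoidalLinear k C]
    [RigidCategory C] [IsFusionCategory k C] (f : 𝟙_ C ⟶ 𝟙_ C) : k :=
  (Equiv.ofBijective _ (IsFusionCategory.end_unit (k := k) (C := C))).symm f

/-! ### Duals, invertible objects, pivotal and spherical structures -/

section Rigid

variable {C : Type u} [Category.{v} C] [MonoidalCategory C] [RigidCategory C]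

/-- The dual `X*` of `X`, with evaluation `ε_ X X* : X* ⊗ X ⟶ 𝟙` and coevaluation
`η_ X X* : 𝟙 ⟶ X ⊗ X*`. -/
abbrev du (X : C) : C := HasRightDual.rightDual X

/-- The dual `f* : Y* ⟶ X*` of a morphism `f : X ⟶ Y`. -/
abbrev duMap {X Y : C} (f : X ⟶ Y) : du Y ⟶ du X := rightAdjointMate f

/-- An object is invertible if its evaluation and coevaluation are isomorphisms. -/
def IsInvertibleObj (X : C) : Prop := IsIso (ε_ X (du X)) ∧ IsIso (η_ X (du X))

/-- The canonical isomorphism `(X ⊗ Y)* ≅ Y* ⊗ X*`. -/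
def duTensorIso (X Y : C) : du (X ⊗ Y) ≅ du Y ⊗ du X :=
  rightDualIso (HasRightDual.exact : ExactPairing (X ⊗ Y) (du (X ⊗ Y)))
    (ExactPairing.tensor : ExactPairing (X ⊗ Y) (du Y ⊗ du X))

/-- The canonical morphism (an isomorphism) `(X ⊗ Y)** ⟶ X** ⊗ Y**`. -/
def doubleDualTensor (X Y : C) : du (du (X ⊗ Y)) ⟶ du (du X) ⊗ du (du Y) :=
  duMap (duTensorIso X Y).inv ≫ (duTensorIso (du Y) (du X)).hom

variable (C) in
/-- A pivotal structure: an isomorphism of tensor functors from the identity functor to the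
double dual functor. -/
class PivotalCategory where
  /-- The components `X ≅ X**` of the isomorphism. -/
  pivot : ∀ X : C, X ≅ du (du X)
  naturality : ∀ {X Y : C} (f : X ⟶ Y),
    f ≫ (pivot Y).hom = (pivot X).hom ≫ duMap (duMap f)
  tensor : ∀ X Y : C,
    (pivot (X ⊗ Y)).hom ≫ doubleDualTensor X Y = (pivot X).hom ⊗ₘ (pivot Y).hom

variable [PivotalCategory C]

/-- The left trace of an endomorphism, with values in `End(𝟙)`. -/
def leftTrace {X : C} (f : X ⟶ X) : 𝟙_ C ⟶ 𝟙_ C :=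
  η_ X (du X) ≫ (f ≫ (PivotalCategory.pivot X).hom) ▷ du X ≫ ε_ (du X) (du (du X))

/-- The right trace of an endomorphism, with values in `End(𝟙)`. -/
def rightTrace {X : C} (f : X ⟶ X) : 𝟙_ C ⟶ 𝟙_ C :=
  η_ (du X) (du (du X)) ≫ du X ◁ ((PivotalCategory.pivot X).inv ≫ f) ≫ ε_ X (du X)

variable (C) in
/-- A pivotal structure is spherical if left and right traces agree. -/
class IsSpherical : Prop where
  leftTrace_eq_rightTrace : ∀ {X : C} (f : X ⟶ X), leftTrace f = rightTrace f

end Rigid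

/-! ### Modular categories -/

section Modular

variable (k : Type*) [Field k] (C : Type u) [Category.{v} C] [Abelian C] [Linear k C]
  [MonoidalCategory C] [MonoidalPreadditive C] [MonoidalLinear k C] [RigidCategory C]
  [IsFusionCategory k C] [BraidedCategory C] [PivotalCategory C]

/-- The `S`-matrix: `s_{X,Y}` is the trace of `c_{Y,X} ∘ c_{X,Y}`. -/
def sMatrix : Matrix (Irr C) (Irr C) k := fun x y =>
  endUnitScalar k (leftTrace ((β_ x.rep y.rep).hom ≫ (β_ y.rep x.rep).hom))

open scoped Classical in
/-- A braided fusion category with a pivotal structure is a modular tensor category if the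
pivotal structure is spherical and the `S`-matrix is non-degenerate. -/
class IsModular : Prop extends IsSpherical C where
  sMatrix_det_ne_zero :
    haveI : Finite (Irr C) := IsFusionCategory.finite_irr k
    letI : Fintype (Irr C) := Fintype.ofFinite (Irr C)
    (sMatrix k C).det ≠ 0

end Modular

/-! ### Frobenius-Perron dimension -/

section FPdim

variable {C : Type u} [Category.{v} C] [Abelian C] [MonoidalCategory C]

/-- `d` is the Frobenius-Perron dimension of a fusion category `C`: the unique ring homomorphism
from the Grothendieck ring of `C` to `ℝ` with `d X ≥ 1` for all `X ≠ 0`. As `C` is semisimple,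
a ring homomorphism on the Grothendieck ring is the same as an isomorphism-invariant function on
objects that is additive on direct sums, multiplicative on tensor products and unital. -/
structure IsFPdim (d : C → ℝ) : Prop where
  iso : ∀ {X Y : C}, (X ≅ Y) → d X = d Y
  add : ∀ X Y : C, d (X ⊞ Y) = d X + d Y
  mul : ∀ X Y : C, d (X ⊗ Y) = d X * d Y
  unit : d (𝟙_ C) = 1
  one_le : ∀ X : C, ¬ IsZero X → 1 ≤ d X

variable (C) in
/-- `C` is odd-dimensional: `FPdim(C) = ∑_{X ∈ 𝒪(C)} FPdim(X)²` is an odd integer. -/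
def IsOddDimensional : Prop :=
  ∃ d : C → ℝ, IsFPdim d ∧ ∃ n : ℕ, Odd n ∧ ∑ᶠ s : Irr C, d s.rep ^ 2 = n

end FPdim

/-! ### Fusion subcategories, gradings -/

section Gradings

variable {C : Type u} [Category.{v} C] [Abelian C] [MonoidalCategory C] [RigidCategory C]

/-- Fusion subcategories of a fusion category: full replete subcategories containing the unit
and zero objects, closed under direct sums, direct summands, tensor products and duals. -/
structure IsFusionSubcategory (P : ObjectProperty C) : Prop where
  iso : ∀ {X Y : C}, (X ≅ Y) → P X → P Y
  zero : P 0
  biprod : ∀ {X Y : C}, P X → P Y → P (X ⊞ Y)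
  summand : ∀ {X Y : C}, P (X ⊞ Y) → P X
  unit : P (𝟙_ C)
  tensor : ∀ {X Y : C}, P X → P Y → P (X ⊗ Y)
  dual : ∀ {X : C}, P X → P (du X)

variable (C) in
/-- The adjoint subcategory `C_ad`: the fusion subcategory generated by the objects `X ⊗ X*`
for `X` simple. -/
def adjointSubcategory : ObjectProperty C := fun Y =>
  ∀ P : ObjectProperty C, IsFusionSubcategory P →
    (∀ X : C, Simple X → P (X ⊗ du X)) → P Y

variable (C) in
/-- A grading of `C` by a finite group `G`: a decomposition `C = ⨁ C_g` into full replete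
subcategories (every object is a direct sum of objects of the `C_g`, and there are no nonzero
morphisms between different components) compatible with tensor product, unit and duals.
That each `C_g` is closed under direct sums, kernels and cokernels follows from the
decomposition. -/
structure Grading (G : Type w) [Group G] [Finite G] where
  /-- The component `C_g`. -/
  comp : G → ObjectProperty C
  iso : ∀ {g : G} {X Y : C}, (X ≅ Y) → comp g X → comp g Y
  hom_eq_zero : ∀ {g h : G}, g ≠ h → ∀ {X Y : C}, comp g X → comp h Y →
    ∀ f : X ⟶ Y, f = 0
  decomposition : ∀ X : C, ∃ Y : G → C, (∀ g, comp g (Y g)) ∧ Nonempty (X ≅ ⨁ Y)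
  tensor : ∀ {g h : G} {X Y : C}, comp g X → comp h Y → comp (g * h) (X ⊗ Y)
  unit : comp 1 (𝟙_ C)
  dual : ∀ {g : G} {X : C}, comp g X → comp g⁻¹ (du X)

/-- A grading is faithful if all its components are nonzero. -/
def Grading.IsFaithful {G : Type w} [Group G] [Finite G] (D : Grading C G) : Prop :=
  ∀ g : G, ∃ X : C, D.comp g X ∧ ¬ IsZero X

/-- A faithful grading is the universal grading if every faithful grading is obtained from it
by a group homomorphism (necessarily unique and surjective). -/
structure Grading.IsUniversal {U : Type w} [Group U] [Finite U] (D : Grading C U) : Prop where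
  faithful : D.IsFaithful
  universal : ∀ (G : Type w) [Group G] [Finite G] (E : Grading C G), E.IsFaithful →
    ∃ φ : U →* G, ∀ (u : U) (X : C), D.comp u X → E.comp (φ u) X

end Gradings

end ModularTensor

end

open CategoryTheory CategoryTheory.Limits CategoryTheory.MonoidalCategory

noncomputable section

namespace ModularTensor

attribute [local instance] Abelian.hasFiniteBiproducts

universe w v u

/-! ### Biproducts and retracts in abelian categories -/

section Abelian

variable {C : Type u} [Category.{v} C] [Abelian C]

/-! If `X` is an invertible object of `C_g`, then `X ⊗ -` is an autoequivalence of `C` with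
quasi-inverse `X* ⊗ -`. These two functors exchange `C_1` and `C_g`, so the two components have the
same rank (`Grading.rank_comp_eq_of_isInvertibleObj`). It remains to identify `C_1` with `C_ad`
(`Grading.IsUniversal.comp_one_eq`).

The inclusion of `C_ad` in `C_1` is formal, since `S ⊗ S*` has degree `g g⁻¹ = 1` for every simple
`S` of degree `g`. For the converse, a faithful grading with trivial component `C_ad` is built: `A`
and `B` have the same degree when `A ⊗ B*` lies in `C_ad`. Semisimplicity makes this relation
transitive through nonzero objects; the braiding and the pivotal structure make it compatible with
tensor products and duals. Its classes form a finite group, and the homomorphism given by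
universality sends `1` to `1`, so `C_1` lies in `C_ad`. -/

/-- The biproduct over `Option J` splits off the summand indexed by `none`. -/
def biproductOptionIso {J : Type w} [Finite J] (f : Option J → C) :
    ⨁ f ≅ f none ⊞ ⨁ fun j => f (some j) where
  hom := biprod.lift (biproduct.π f none) (biproduct.lift fun j => biproduct.π f (some j))
  inv := biprod.desc (biproduct.ι f none) (biproduct.desc fun j => biproduct.ι f (some j))
  hom_inv_id := by
    classical
    apply biproduct.hom_ext'
    rintro (_ | j)
    · apply biproduct.hom_ext
      intro i
      have h : biproduct.ι f none ≫ biproduct.lift (fun j => biproduct.π f (some j)) = 0 := by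
        apply biproduct.hom_ext; intro j; simp
      simp [biprod.lift_desc, reassoc_of% h]
    · have h : biproduct.ι f (some j) ≫ biproduct.lift (fun j => biproduct.π f (some j)) =
          biproduct.ι (fun j => f (some j)) j := by
        apply biproduct.hom_ext; intro i
        by_cases hij : j = i
        · subst hij; simp
        · simp [hij]
      simp [biprod.lift_desc, reassoc_of% h]
  inv_hom_id := by
    classical
    apply biprod.hom_ext'
    · apply biprod.hom_ext
      · simp
      · apply biproduct.hom_ext; intro j
        simp
    · apply biproduct.hom_ext'; intro i
      apply biprod.hom_ext
      · simp
      · apply biproduct.hom_ext; intro j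
        by_cases hij : i = j
        · subst hij; simp
        · simp [hij]

/-- A property of objects that is closed under isomorphisms, zero and binary biproducts is
closed under finite biproducts. -/
theorem prop_biproduct {P : ObjectProperty C} (iso : ∀ {X Y : C}, (X ≅ Y) → P X → P Y)
    (zero : ∀ X, IsZero X → P X) (biprod : ∀ {X Y : C}, P X → P Y → P (X ⊞ Y))
    {J : Type w} [Finite J] (f : J → C) (hf : ∀ j, P (f j)) : P (⨁ f) := by
  refine Finite.induction_empty_option
    (P := fun J => ∀ [Finite J] (f : J → C), (∀ j, P (f j)) → P (⨁ f)) ?_ ?_ ?_ J f hf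
  · intro J K e ih _ f hf
    have := Finite.of_equiv _ e.symm
    exact iso (biproduct.whiskerEquiv e fun _ => Iso.refl _) (ih (fun j => f (e j)) fun j => hf _)
  · intro _ f _
    exact zero _ ((IsZero.iff_id_eq_zero _).2 (biproduct.hom_ext _ _ fun j => j.elim))
  · intro J _ ih _ f hf
    exact iso (biproductOptionIso f).symm (biprod (hf none) (ih _ fun j => hf _))

/-- A biproduct with only one nonzero summand is isomorphic to that summand. -/
theorem nonempty_iso_biproduct {J : Type w} [Finite J] (f : J → C) (j : J)
    (h : ∀ i, i ≠ j → IsZero (f i)) : Nonempty (f j ≅ ⨁ f) := by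
  classical
  refine ⟨⟨biproduct.ι f j, biproduct.π f j, by simp, ?_⟩⟩
  apply biproduct.hom_ext'
  intro i
  by_cases hi : i = j
  · subst hi; simp
  · exact (h i hi).eq_of_src _ _

/-- A retract is a direct summand. -/
theorem nonempty_biprod_iso_of_retract {X Y : C} (h : Retract X Y) :
    ∃ Z : C, Nonempty (Y ≅ X ⊞ Z) := by
  let s : ShortComplex C := ShortComplex.mk h.i (cokernel.π h.i) (by simp)
  have hs : s.Exact := ShortComplex.exact_cokernel h.i
  have : Epi s.g := inferInstanceAs (Epi (cokernel.π h.i))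
  exact ⟨_, ⟨(ShortComplex.Splitting.ofExactOfRetraction s hs h.r h.retract this).isoBinaryBiproduct⟩⟩

theorem isZero_of_retract {X Y : C} (h : Retract X Y) (hY : IsZero Y) : IsZero X := by
  rw [IsZero.iff_id_eq_zero, ← h.retract, hY.eq_of_src h.r 0, comp_zero]

end Abelian

section Retracts

variable {C : Type u} [Category.{v} C] [MonoidalCategory C]

/-- Tensor products of retracts are retracts. -/
def retractTensor {X Y X' Y' : C} (h : Retract X Y) (h' : Retract X' Y') :
    Retract (X ⊗ X') (Y ⊗ Y') where
  i := h.i ⊗ₘ h'.i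
  r := h.r ⊗ₘ h'.r
  retract := by rw [tensorHom_comp_tensorHom, h.retract, h'.retract, id_tensorHom_id]

/-- Duals of retracts are retracts. -/
def retractDu [RigidCategory C] {X Y : C} (h : Retract X Y) : Retract (du X) (du Y) where
  i := duMap h.r
  r := duMap h.i
  retract := by
    rw [← comp_rightAdjointMate, h.retract, rightAdjointMate_id]

end Retracts

/-! ### Semisimplicity -/

section Semisimple

variable (k : Type*) [Field k] {C : Type u} [Category.{v} C] [Abelian C] [Linear k C]
  [MonoidalCategory C] [MonoidalPreadditive C] [MonoidalLinear k C] [RigidCategory C]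
  [IsFusionCategory k C]

include k

/-- Some component of `f` into a simple summand of `X` is nonzero, hence invertible by Schur's
lemma; its inverse yields the retraction. -/
theorem nonempty_retract_of_ne_zero {S X : C} [Simple S] (f : S ⟶ X) (hf : f ≠ 0) :
    Nonempty (Retract S X) := by
  obtain ⟨n, T, hT, ⟨e⟩⟩ := IsFusionCategory.semisimple (k := k) X
  obtain ⟨i, hi⟩ : ∃ i, f ≫ e.hom ≫ biproduct.π T i ≠ 0 := by
    by_contra! h
    apply hf
    rw [← cancel_mono e.hom]
    apply biproduct.hom_ext
    intro i
    simpa using h i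
  have := hT i
  have := isIso_of_hom_simple hi
  exact ⟨⟨f, e.hom ≫ biproduct.π T i ≫ inv (f ≫ e.hom ≫ biproduct.π T i), by
    simpa only [Category.assoc] using IsIso.hom_inv_id (f ≫ e.hom ≫ biproduct.π T i)⟩⟩

/-- A nonzero morphism forces a common simple summand. -/
theorem exists_simple_retract_of_ne_zero {X Y : C} (f : X ⟶ Y) (hf : f ≠ 0) :
    ∃ S : C, Simple S ∧ Nonempty (Retract S X) ∧ Nonempty (Retract S Y) := by
  obtain ⟨n, T, hT, ⟨e⟩⟩ := IsFusionCategory.semisimple (k := k) X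
  obtain ⟨i, hi⟩ : ∃ i, biproduct.ι T i ≫ e.inv ≫ f ≠ 0 := by
    by_contra! h
    apply hf
    rw [← cancel_epi e.inv]
    apply biproduct.hom_ext'
    intro i
    simpa using h i
  have := hT i
  exact ⟨T i, hT i, ⟨⟨biproduct.ι T i ≫ e.inv, e.hom ≫ biproduct.π T i, by simp⟩⟩,
    nonempty_retract_of_ne_zero k _ hi⟩

theorem exists_simple_retract {X : C} (hX : ¬ IsZero X) :
    ∃ S : C, Simple S ∧ Nonempty (Retract S X) := by
  obtain ⟨S, hS, h, -⟩ := exists_simple_retract_of_ne_zero k (𝟙 X)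
    (fun h => hX ((IsZero.iff_id_eq_zero X).2 h))
  exact ⟨S, hS, h⟩

theorem simple_tensorUnit : Simple (𝟙_ C) := by
  obtain ⟨n, T, hT, ⟨e⟩⟩ := IsFusionCategory.semisimple (k := k) (𝟙_ C)
  have hbij := IsFusionCategory.end_unit (k := k) (C := C)
  have hne : 𝟙 (𝟙_ C) ≠ 0 := fun h => by
    have := hbij.1 (a₁ := 1) (a₂ := 0) (by simp [h])
    exact one_ne_zero this
  obtain ⟨S, hS, ⟨r⟩, -⟩ := exists_simple_retract_of_ne_zero k _ hne
  -- The idempotent of `End(𝟙)` cutting out the simple summand `S` is a scalar. It fixes `r.i ≠ 0`,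
  -- so the scalar is `1` and `S ≅ 𝟙`.
  obtain ⟨a, ha⟩ := hbij.2 (r.r ≫ r.i)
  have h1 : r.i = a • r.i := by
    have : r.i ≫ (a • 𝟙 (𝟙_ C)) = r.i ≫ r.r ≫ r.i := congrArg (r.i ≫ ·) ha
    rw [r.retract_assoc] at this
    simpa using this.symm
  have h2 : a = 1 := by
    by_contra h
    have : (1 - a) • r.i = 0 := by rw [sub_smul, one_smul, ← h1, sub_self]
    have hz : r.i = 0 := (smul_eq_zero.1 this).resolve_left (sub_ne_zero.2 (Ne.symm h))
    exact id_nonzero S (by rw [← r.retract, hz, zero_comp])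
  have h3 : r.r ≫ r.i = 𝟙 (𝟙_ C) := by rw [← one_smul k (𝟙 (𝟙_ C)), ← h2]; exact ha.symm
  exact Simple.of_iso (⟨r.r, r.i, h3, r.retract⟩ : 𝟙_ C ≅ S)

/-- The unit object is a direct summand of `X ⊗ X*` for every nonzero `X`. -/
theorem nonempty_retract_tensor_du {X : C} (hX : ¬ IsZero X) :
    Nonempty (Retract (𝟙_ C) (X ⊗ du X)) := by
  have := simple_tensorUnit k (C := C)
  -- If the coevaluation vanished, the zigzag identity would give `𝟙 X = 0`.
  refine nonempty_retract_of_ne_zero k (η_ X (du X)) fun h => hX ?_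
  rw [IsZero.iff_id_eq_zero]
  have := ExactPairing.evaluation_coevaluation X (du X)
  rw [h] at this
  simp only [MonoidalPreadditive.zero_whiskerRight, zero_comp] at this
  rw [← cancel_epi (λ_ X).hom, ← cancel_mono (ρ_ X).inv]
  simpa using this.symm

end Semisimple

/-! ### Fusion subcategories -/

section FusionSubcategory

variable {C : Type u} [Category.{v} C] [Abelian C] [MonoidalCategory C] [RigidCategory C]

theorem IsFusionSubcategory.retract {P : ObjectProperty C} (hP : IsFusionSubcategory P) {X Y : C}
    (h : Retract X Y) (hY : P Y) : P X := by
  obtain ⟨Z, ⟨e⟩⟩ := nonempty_biprod_iso_of_retract h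
  exact hP.summand (hP.iso e hY)

theorem isFusionSubcategory_adjointSubcategory : IsFusionSubcategory (adjointSubcategory C) where
  iso e h P hP hS := hP.iso e (h P hP hS)
  zero _ hP _ := hP.zero
  biprod h h' P hP hS := hP.biprod (h P hP hS) (h' P hP hS)
  summand h P hP hS := hP.summand (h P hP hS)
  unit _ hP _ := hP.unit
  tensor h h' P hP hS := hP.tensor (h P hP hS) (h' P hP hS)
  dual h P hP hS := hP.dual (h P hP hS)

theorem adjointSubcategory_tensor_du (X : C) (hX : Simple X) :
    adjointSubcategory C (X ⊗ du X) := fun _ _ hS => hS X hX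

end FusionSubcategory

/-! ### The grading with a given trivial component -/

section QuotientGrading

/-- `A` and `B` lie in the same component relative to `P` if `A ⊗ B*` lies in `P`. -/
def SameComponent {C : Type u} [Category.{v} C] [MonoidalCategory C] [RigidCategory C]
    (P : ObjectProperty C) (A B : C) : Prop := P (A ⊗ du B)

variable {C : Type u} [Category.{v} C] [Abelian C] [MonoidalCategory C] [RigidCategory C]
  {P : ObjectProperty C}

theorem SameComponent.retract_left (hP : IsFusionSubcategory P) {A A' B : C}
    (h : Retract A A') (hA : SameComponent P A' B) : SameComponent P A B :=
  hP.retract (retractTensor h (Retract.refl _)) hA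

theorem SameComponent.retract_right (hP : IsFusionSubcategory P) {A B B' : C}
    (h : Retract B B') (hB : SameComponent P A B') : SameComponent P A B :=
  hP.retract (retractTensor (Retract.refl _) (retractDu h)) hB

/-- Dualizing gives `(A ⊗ B*)* ≅ B** ⊗ A* ≅ B ⊗ A*`, the last step by the pivotal structure. -/
theorem SameComponent.symm [PivotalCategory C] (hP : IsFusionSubcategory P) {A B : C}
    (h : SameComponent P A B) : SameComponent P B A :=
  hP.iso (duTensorIso A (du B) ≪≫ whiskerRightIso (PivotalCategory.pivot B).symm (du A))
    (hP.dual h)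

theorem sameComponent_unit_iff (hP : IsFusionSubcategory P) {A : C} :
    SameComponent P A (𝟙_ C) ↔ P A := by
  let e : du (𝟙_ C) ≅ 𝟙_ C :=
    rightDualIso (RightRigidCategory.rightDual (𝟙_ C)).exact exactPairingUnit
  let e' : A ⊗ du (𝟙_ C) ≅ A := whiskerLeftIso A e ≪≫ ρ_ A
  exact ⟨hP.iso e', hP.iso e'.symm⟩

/-- The braiding rearranges `(A ⊗ B*) ⊗ (A' ⊗ B'*)` into `(A ⊗ A') ⊗ (B ⊗ B')*`. -/
theorem SameComponent.tensor [BraidedCategory C] (hP : IsFusionSubcategory P) {A A' B B' : C}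
    (h : SameComponent P A B) (h' : SameComponent P A' B') :
    SameComponent P (A ⊗ A') (B ⊗ B') :=
  hP.iso (⟨tensorμ A (du B) A' (du B'), tensorδ A (du B) A' (du B'),
      tensorμ_tensorδ _ _ _ _, tensorδ_tensorμ _ _ _ _⟩ ≪≫
    whiskerLeftIso (A ⊗ A') (β_ (du B) (du B') ≪≫ (duTensorIso B B').symm)) (hP.tensor h h')

theorem SameComponent.dual [BraidedCategory C] [PivotalCategory C] (hP : IsFusionSubcategory P)
    {A B : C} (h : SameComponent P A B) : SameComponent P (du A) (du B) :=
  hP.iso (β_ B (du A) ≪≫ whiskerLeftIso (du A) (PivotalCategory.pivot B)) (h.symm hP)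

theorem SameComponent.biproduct [MonoidalPreadditive C] (hP : IsFusionSubcategory P) {J : Type w}
    [Finite J] (f : J → C) {B : C} (hf : ∀ j, SameComponent P (f j) B) :
    SameComponent P (⨁ f) B := by
  have hzero (X : C) (hX : IsZero X) : P (X ⊗ du B) := by
    refine hP.iso (IsZero.iso (isZero_zero C) ?_) hP.zero
    rw [IsZero.iff_id_eq_zero, ← id_whiskerRight, hX.eq_of_src (𝟙 X) 0,
      MonoidalPreadditive.zero_whiskerRight]
  refine prop_biproduct (P := fun A => SameComponent P A B)
    (fun e h => h.retract_left hP (Retract.ofIso e.symm)) hzero (fun {X Y} hX hY => ?_) f hf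
  have := preservesBinaryBiproducts_of_preservesBiproducts (tensorRight (du B))
  exact hP.iso ((tensorRight (du B)).mapBiprod X Y).symm (hP.biprod hX hY)

variable (k : Type*) [Field k] [Linear k C] [MonoidalPreadditive C] [MonoidalLinear k C]
  [IsFusionCategory k C]

-- As `B` is nonzero, `𝟙` is a summand of `B* ⊗ B`, so `A ⊗ D*` is a summand of `(A ⊗ B*) ⊗ (B ⊗
-- D*)`.
include k in
theorem SameComponent.trans [BraidedCategory C] (hP : IsFusionSubcategory P) {A B D : C}
    (hB : ¬ IsZero B) (h : SameComponent P A B) (h' : SameComponent P B D) :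
    SameComponent P A D := by
  obtain ⟨r⟩ := nonempty_retract_tensor_du k hB
  let r' : Retract (𝟙_ C) (du B ⊗ B) := r.trans (Retract.ofIso (β_ B (du B)))
  let r₁ : Retract (A ⊗ du D) (A ⊗ (𝟙_ C ⊗ du D)) :=
    Retract.ofIso (whiskerLeftIso A (λ_ (du D)).symm)
  let r₂ : Retract (A ⊗ (𝟙_ C ⊗ du D)) (A ⊗ ((du B ⊗ B) ⊗ du D)) :=
    retractTensor (Retract.refl _) (retractTensor r' (Retract.refl _))
  let e : (A ⊗ du B) ⊗ (B ⊗ du D) ≅ A ⊗ ((du B ⊗ B) ⊗ du D) :=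
    α_ A (du B) (B ⊗ du D) ≪≫ whiskerLeftIso A (α_ (du B) B (du D)).symm
  exact hP.retract (r₁.trans r₂) (hP.iso e (hP.tensor h h'))

-- As `A` is nonzero, `B` is a summand of `A* ⊗ (A ⊗ B)`.
include k in
theorem not_isZero_tensor [BraidedCategory C] {A B : C} (hA : ¬ IsZero A) (hB : ¬ IsZero B) :
    ¬ IsZero (A ⊗ B) := fun h => hB <| by
  obtain ⟨r⟩ := nonempty_retract_tensor_du k hA
  let r' : Retract (𝟙_ C) (du A ⊗ A) := r.trans (Retract.ofIso (β_ A (du A)))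
  let r₁ : Retract B ((du A ⊗ A) ⊗ B) :=
    (Retract.ofIso (λ_ B).symm).trans (retractTensor r' (Retract.refl B))
  refine isZero_of_retract (r₁.trans (Retract.ofIso (α_ (du A) A B))) ?_
  rw [IsZero.iff_id_eq_zero, ← whiskerLeft_id, h.eq_of_src (𝟙 (A ⊗ B)) 0,
    MonoidalPreadditive.whiskerLeft_zero]

theorem not_isZero_du [PivotalCategory C] {A : C} (hA : ¬ IsZero A) : ¬ IsZero (du A) := fun h => by
  refine hA (IsZero.of_iso ?_ (PivotalCategory.pivot A))
  have hz : 𝟙 (du A) = 0 := h.eq_of_src _ _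
  rw [IsZero.iff_id_eq_zero, ← rightAdjointMate_id, hz]
  simp [rightAdjointMate]

/-- The nonzero objects that lie in a single component relative to `P`. -/
def HomogeneousObj (P : ObjectProperty C) : Type u := {A : C // ¬ IsZero A ∧ SameComponent P A A}

/-- Lying in the same component, as an equivalence relation. -/
def homogeneousSetoid [BraidedCategory C] [PivotalCategory C] (hP : IsFusionSubcategory P) :
    Setoid (HomogeneousObj P) where
  r A B := SameComponent P A.1 B.1
  -- Reflexivity is exactly the homogeneity condition, and transitivity uses that the middle object
  -- is nonzero.
  iseqv := ⟨fun A => A.2.2, fun h => h.symm hP, fun {_ B _} h h' => h.trans k hP B.2.1 h'⟩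

/-- The set of components relative to `P`. -/
def ComponentGroup [BraidedCategory C] [PivotalCategory C] (hP : IsFusionSubcategory P) : Type u :=
  Quotient (homogeneousSetoid k hP)

variable [BraidedCategory C] [PivotalCategory C]

/-- The group axioms come from the associator and unitors, as isomorphic homogeneous objects lie in
the same component. For inverses, `A* ⊗ A ≅ A ⊗ A*` lies in `P` by homogeneity of `A`. -/
instance (hP : IsFusionSubcategory P) : Group (ComponentGroup k hP) where
  mul := Quotient.map₂ (fun A B => ⟨A.1 ⊗ B.1, not_isZero_tensor k A.2.1 B.2.1,
    A.2.2.tensor hP B.2.2⟩) fun _ _ h _ _ h' => h.tensor hP h'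
  one := Quotient.mk _ ⟨𝟙_ C, have := simple_tensorUnit k (C := C); Simple.not_isZero _,
    (sameComponent_unit_iff hP).2 hP.unit⟩
  inv := Quotient.map (fun A => ⟨du A.1, not_isZero_du A.2.1, A.2.2.dual hP⟩) fun _ _ h => h.dual hP
  mul_assoc := by
    rintro ⟨A⟩ ⟨B⟩ ⟨D⟩
    exact Quotient.sound (((A.2.2.tensor hP B.2.2).tensor hP D.2.2).retract_right hP
      (Retract.ofIso (α_ A.1 B.1 D.1).symm))
  one_mul := by
    rintro ⟨A⟩
    exact Quotient.sound (A.2.2.retract_left hP (Retract.ofIso (λ_ A.1)))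
  mul_one := by
    rintro ⟨A⟩
    exact Quotient.sound (A.2.2.retract_left hP (Retract.ofIso (ρ_ A.1)))
  inv_mul_cancel := by
    rintro ⟨A⟩
    exact Quotient.sound ((sameComponent_unit_iff hP).2 (hP.iso (β_ A.1 (du A.1)) A.2.2))

/-- A homogeneous object in a given component. -/
def ComponentGroup.rep {hP : IsFusionSubcategory P} (g : ComponentGroup k hP) : C :=
  (Quotient.out (s := homogeneousSetoid k hP) g).1

variable {k}

theorem ComponentGroup.not_isZero_rep {hP : IsFusionSubcategory P} (g : ComponentGroup k hP) :
    ¬ IsZero g.rep := (Quotient.out (s := homogeneousSetoid k hP) g).2.1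

theorem ComponentGroup.sameComponent_rep {hP : IsFusionSubcategory P} (g : ComponentGroup k hP) :
    SameComponent P g.rep g.rep := (Quotient.out (s := homogeneousSetoid k hP) g).2.2

theorem ComponentGroup.eq_of_sameComponent {hP : IsFusionSubcategory P} {g h : ComponentGroup k hP}
    (H : SameComponent P g.rep h.rep) : g = h := by
  rw [← Quotient.out_eq (s := homogeneousSetoid k hP) g,
    ← Quotient.out_eq (s := homogeneousSetoid k hP) h]
  exact Quotient.sound H

theorem ComponentGroup.mk_rep {hP : IsFusionSubcategory P} (A : HomogeneousObj P) :
    SameComponent P A.1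
      (ComponentGroup.rep k (hP := hP) (Quotient.mk (homogeneousSetoid k hP) A)) :=
  (homogeneousSetoid k hP).symm (Quotient.mk_out A)

-- A homogeneous object lies in the component of each of its simple summands, so the finitely many
-- simple classes surject onto the components.
variable (k) in
theorem finite_componentGroup (hP : IsFusionSubcategory P)
    (hS : ∀ X : C, Simple X → P (X ⊗ du X)) : Finite (ComponentGroup k hP) := by
  have := IsFusionCategory.finite_irr (k := k) (C := C)
  have hsimple (s : Irr C) : Simple s.rep := (Quotient.out (s := simpleSetoid C) s).2
  refine Finite.of_surjective (fun s : Irr C => (Quotient.mk (homogeneousSetoid k hP)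
    ⟨s.rep, (hsimple s).not_isZero, hS _ (hsimple s)⟩ : ComponentGroup k hP)) ?_
  rintro ⟨A⟩
  obtain ⟨S, hS', ⟨r⟩⟩ := exists_simple_retract k A.2.1
  obtain ⟨e⟩ : Nonempty (Irr.rep (Quotient.mk (simpleSetoid C) ⟨S, hS'⟩) ≅ S) :=
    Quotient.mk_out (s := simpleSetoid C) ⟨S, hS'⟩
  exact ⟨Quotient.mk (simpleSetoid C) ⟨S, hS'⟩,
    Quotient.sound (A.2.2.retract_left hP ((Retract.ofIso e).trans r))⟩

/-- The grading of `C` by the components relative to a fusion subcategory `P` that contains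
`X ⊗ X*` for all simple `X`. -/
def componentGrading (hP : IsFusionSubcategory P) (hS : ∀ X : C, Simple X → P (X ⊗ du X))
    [Finite (ComponentGroup k hP)] : Grading C (ComponentGroup k hP) where
  comp g A := SameComponent P A g.rep
  iso e h := h.retract_left hP (Retract.ofIso e.symm)
  hom_eq_zero {g h} hgh X Y hX hY f := by
    by_contra hf
    -- A common simple summand of `X` and `Y` would link the components `g` and `h`.
    obtain ⟨S, hS', ⟨r⟩, ⟨r'⟩⟩ := exists_simple_retract_of_ne_zero k f hf
    exact hgh (ComponentGroup.eq_of_sameComponent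
      (((hX.retract_left hP r).symm hP).trans k hP hS'.not_isZero (hY.retract_left hP r')))
  decomposition X := by
    obtain ⟨n, T, hT, ⟨e⟩⟩ := IsFusionCategory.semisimple (k := k) X
    let c (i : Fin n) : ComponentGroup k hP :=
      Quotient.mk (homogeneousSetoid k hP) ⟨T i, (hT i).not_isZero, hS _ (hT i)⟩
    -- The simple summands of `X` are collected according to their component.
    refine ⟨fun g => ⨁ fun i : {i // c i = g} => T i, fun g => ?_, ⟨e ≪≫ ?_⟩⟩
    · refine SameComponent.biproduct hP _ ?_
      rintro ⟨i, rfl⟩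
      exact ComponentGroup.mk_rep (k := k) (hP := hP) ⟨T i, _⟩
    · exact (biproduct.whiskerEquiv (Equiv.sigmaFiberEquiv c) fun _ => Iso.refl _).symm ≪≫
        (biproductBiproductIso (fun g => {i // c i = g}) fun _ i => T i).symm
  tensor {g h X Y} hX hY := by
    refine (hX.tensor hP hY).trans k hP (not_isZero_tensor k g.not_isZero_rep h.not_isZero_rep) ?_
    have : g * h = Quotient.mk (homogeneousSetoid k hP) ⟨g.rep ⊗ h.rep,
        not_isZero_tensor k g.not_isZero_rep h.not_isZero_rep,
        g.sameComponent_rep.tensor hP h.sameComponent_rep⟩ := by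
      conv_lhs => rw [← Quotient.out_eq (s := homogeneousSetoid k hP) g,
        ← Quotient.out_eq (s := homogeneousSetoid k hP) h]
      rfl
    rw [this]
    exact ComponentGroup.mk_rep ⟨g.rep ⊗ h.rep, _⟩
  unit := ComponentGroup.mk_rep (k := k) (hP := hP) ⟨𝟙_ C, _⟩
  dual {g X} hX := by
    refine (hX.dual hP).trans k hP (not_isZero_du g.not_isZero_rep) ?_
    have : g⁻¹ = Quotient.mk (homogeneousSetoid k hP) ⟨du g.rep, not_isZero_du g.not_isZero_rep,
        g.sameComponent_rep.dual hP⟩ := by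
      conv_lhs => rw [← Quotient.out_eq (s := homogeneousSetoid k hP) g]
      rfl
    rw [this]
    exact ComponentGroup.mk_rep ⟨du g.rep, _⟩

theorem componentGrading_isFaithful (hP : IsFusionSubcategory P)
    (hS : ∀ X : C, Simple X → P (X ⊗ du X)) [Finite (ComponentGroup k hP)] :
    (componentGrading (k := k) hP hS).IsFaithful :=
  fun g => ⟨g.rep, g.sameComponent_rep, g.not_isZero_rep⟩

/-- The chosen representative of `1` need not be `𝟙_ C`, but it lies in the same component, and
transitivity applies. -/
theorem componentGrading_comp_one (hP : IsFusionSubcategory P)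
    (hS : ∀ X : C, Simple X → P (X ⊗ du X)) [Finite (ComponentGroup k hP)] {X : C}
    (hX : (componentGrading (k := k) hP hS).comp 1 X) : P X :=
  (sameComponent_unit_iff hP).1 (SameComponent.trans k hP
    (ComponentGroup.not_isZero_rep (k := k) (hP := hP) 1) hX
    ((ComponentGroup.mk_rep (k := k) (hP := hP) ⟨𝟙_ C, _⟩).symm hP))

end QuotientGrading

/-! ### Properties of gradings -/

section Grading

variable {C : Type u} [Category.{v} C] [Abelian C] [MonoidalCategory C] [RigidCategory C]

/-- Transport of a grading along an isomorphism of groups. -/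
def Grading.transport {G : Type*} [Group G] [Finite G] (D : Grading C G) {H : Type*} [Group H]
    [Finite H] (e : H ≃* G) : Grading C H where
  comp h := D.comp (e h)
  iso i hX := D.iso i hX
  hom_eq_zero hgh _ _ hX hY f := D.hom_eq_zero (e.injective.ne hgh) hX hY f
  decomposition X := by
    obtain ⟨Y, hY, ⟨i⟩⟩ := D.decomposition X
    exact ⟨fun h => Y (e h), fun h => hY _,
      ⟨i ≪≫ (biproduct.whiskerEquiv e.toEquiv fun _ => Iso.refl _).symm⟩⟩
  tensor hX hY := by rw [map_mul]; exact D.tensor hX hY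
  unit := by rw [map_one]; exact D.unit
  dual hX := by rw [map_inv]; exact D.dual hX

theorem Grading.IsFaithful.transport {G : Type*} [Group G] [Finite G] {D : Grading C G}
    (hD : D.IsFaithful) {H : Type*} [Group H] [Finite H] (e : H ≃* G) :
    (D.transport e).IsFaithful := fun h => hD (e h)

variable {G : Type w} [Group G] [Finite G] (D : Grading C G)

/-- An object without nonzero morphisms from the other components lies in the component. -/
theorem Grading.comp_of_forall_hom_eq_zero {g : G} {X : C}
    (h : ∀ i, i ≠ g → ∀ Z : C, D.comp i Z → ∀ f : Z ⟶ X, f = 0) : D.comp g X := by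
  obtain ⟨Y, hY, ⟨e⟩⟩ := D.decomposition X
  -- For `i ≠ g` the inclusion of `Y i` into `X` vanishes by hypothesis, so `Y i` is zero.
  obtain ⟨e'⟩ := nonempty_iso_biproduct Y g fun i hi => by
    have hz : biproduct.ι Y i = 0 := by
      rw [← cancel_mono e.inv, zero_comp]
      exact h i hi _ (hY i) _
    rw [IsZero.iff_id_eq_zero, ← biproduct.ι_π_self, hz, zero_comp]
  exact D.iso (e' ≪≫ e.symm) (hY g)

theorem Grading.comp_of_mono {g : G} {X Y : C} (f : X ⟶ Y) [Mono f] (hY : D.comp g Y) :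
    D.comp g X :=
  D.comp_of_forall_hom_eq_zero fun i hi Z hZ a => by
    rw [← cancel_mono f, zero_comp]
    exact D.hom_eq_zero hi hZ hY _

theorem Grading.exists_comp_of_simple {X : C} (hX : Simple X) : ∃ g, D.comp g X := by
  obtain ⟨Y, hY, ⟨e⟩⟩ := D.decomposition X
  obtain ⟨g, hg⟩ : ∃ g, e.hom ≫ biproduct.π Y g ≠ 0 := by
    by_contra! h
    have : e.hom = 0 := biproduct.hom_ext _ _ fun g => by simpa using h g
    exact id_nonzero X (by rw [← e.hom_inv_id, this, zero_comp])
  have := mono_of_nonzero_from_simple hg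
  exact ⟨g, D.comp_of_mono (e.hom ≫ biproduct.π Y g) (hY g)⟩

theorem Grading.isFusionSubcategory_comp_one : IsFusionSubcategory (D.comp 1) where
  iso e h := D.iso e h
  zero := D.comp_of_forall_hom_eq_zero fun _ _ _ _ f => (isZero_zero C).eq_of_tgt f 0
  biprod hX hY := D.comp_of_forall_hom_eq_zero fun i hi Z hZ f => by
    apply biprod.hom_ext
    · rw [zero_comp]; exact D.hom_eq_zero hi hZ hX _
    · rw [zero_comp]; exact D.hom_eq_zero hi hZ hY _
  summand {X Y} h := D.comp_of_mono (biprod.inl : X ⟶ X ⊞ Y) h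
  unit := D.unit
  tensor hX hY := by simpa using D.tensor hX hY
  dual hX := by simpa using D.dual hX

/-- The adjoint subcategory is contained in the trivial component of every grading. -/
theorem Grading.comp_one_of_adjointSubcategory {X : C} (hX : adjointSubcategory C X) :
    D.comp 1 X := by
  refine hX _ D.isFusionSubcategory_comp_one fun S hS => ?_
  obtain ⟨g, hg⟩ := D.exists_comp_of_simple hS
  simpa using D.tensor hg (D.dual hg)

/-- The trivial component of the universal grading of a braided pivotal fusion category is the
adjoint subcategory. -/
theorem Grading.IsUniversal.comp_one_eq (k : Type*) [Field k] [Linear k C] [MonoidalPreadditive C]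
    [MonoidalLinear k C] [IsFusionCategory k C] [BraidedCategory C] [PivotalCategory C]
    {D : Grading C G} (hD : D.IsUniversal) : D.comp 1 = adjointSubcategory C := by
  ext X
  refine ⟨fun hX => ?_, D.comp_one_of_adjointSubcategory⟩
  have hP := isFusionSubcategory_adjointSubcategory (C := C)
  have := finite_componentGroup k hP adjointSubcategory_tensor_du
  -- Universality tests only groups in the universe of `G`; the component group is finite, so it can
  -- be shrunk into that universe.
  obtain ⟨φ, hφ⟩ := hD.universal (Shrink.{w} (ComponentGroup k hP)) _
    ((componentGrading_isFaithful hP adjointSubcategory_tensor_du).transport Shrink.mulEquiv.{w})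
  have h := hφ 1 X hX
  rw [map_one] at h
  refine componentGrading_comp_one (k := k) hP adjointSubcategory_tensor_du ?_
  rw [← map_one (Shrink.mulEquiv.{w} (α := ComponentGroup k hP))]
  exact h

end Grading

/-! ### Tensoring with invertible objects -/

section Invertible

variable {C : Type u} [Category.{v} C] [Abelian C] [MonoidalCategory C]

/-- Tensoring with an object that has an inverse is an equivalence. -/
def tensorLeftEquivalence {X Y : C} (e : X ⊗ Y ≅ 𝟙_ C) (e' : Y ⊗ X ≅ 𝟙_ C) : C ≌ C :=
  CategoryTheory.Equivalence.mk (tensorLeft X) (tensorLeft Y)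
    ((leftUnitorNatIso C).symm ≪≫ (curriedTensor C).mapIso e'.symm ≪≫ tensorLeftTensor Y X)
    ((tensorLeftTensor X Y).symm ≪≫ (curriedTensor C).mapIso e ≪≫ leftUnitorNatIso C)

/-- The equivalence `X ⊗ -` preserves simple objects and is injective on isomorphism classes. -/
theorem rank_le_rank_of_tensor [MonoidalPreadditive C] [Finite (Irr C)] {P Q : ObjectProperty C}
    {X Y : C} (e : X ⊗ Y ≅ 𝟙_ C) (e' : Y ⊗ X ≅ 𝟙_ C) (h : ∀ S, P S → Q (X ⊗ S)) :
    rank P ≤ rank Q := by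
  let F := tensorLeftEquivalence e e'
  have hF (S : C) (hS : Simple S) : Simple (X ⊗ S) := simple_obj F.functor S
  let t : Irr C → Irr C := Quotient.map (fun S => ⟨X ⊗ S.1, hF _ S.2⟩)
    fun _ _ ⟨i⟩ => ⟨whiskerLeftIso X i⟩
  refine Set.ncard_le_ncard_of_injOn t ?_ ?_ (Set.toFinite _)
  · rintro _ ⟨S, rfl, hS⟩
    exact ⟨⟨X ⊗ S.1, hF _ S.2⟩, rfl, h _ hS⟩
  · rintro ⟨S⟩ - ⟨T⟩ - hST
    obtain ⟨i⟩ : Nonempty (X ⊗ S.1 ≅ X ⊗ T.1) := Quotient.exact hST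
    exact Quotient.sound ⟨F.functor.preimageIso (X := S.1) (Y := T.1) i⟩

theorem Grading.rank_comp_eq_of_isInvertibleObj [MonoidalPreadditive C] [RigidCategory C]
    [BraidedCategory C] [Finite (Irr C)] {G : Type w} [Group G] [Finite G] (D : Grading C G)
    {g : G} {X : C} (hX : D.comp g X) (h : IsInvertibleObj X) :
    rank (D.comp g) = rank (D.comp 1) := by
  have := h.1
  have := h.2
  let e : X ⊗ du X ≅ 𝟙_ C := (asIso (η_ X (du X))).symm
  let e' : du X ⊗ X ≅ 𝟙_ C := asIso (ε_ X (du X))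
  -- Tensoring with `X*` carries `C_g` into `C_1`, and tensoring with `X` carries `C_1` into `C_g`.
  refine le_antisymm (rank_le_rank_of_tensor e' e fun S hS => ?_)
    (rank_le_rank_of_tensor e e' fun S hS => ?_)
  · simpa using D.tensor (D.dual hX) hS
  · simpa using D.tensor hX hS

end Invertible

end ModularTensor

end

theorem mainTheorem10 {k : Type*} [Field k] [IsAlgClosed k] [CharZero k]
    {C : Type*} [Category* C] [Abelian C] [Linear k C] [MonoidalCategory C]
    [MonoidalPreadditive C] [MonoidalLinear k C] [RigidCategory C]
    [ModularTensor.IsFusionCategory k C] [BraidedCategory C]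
    [ModularTensor.PivotalCategory C] [ModularTensor.IsModular k C]
    (hodd : ModularTensor.IsOddDimensional C)
    {U : Type*} [Group U] [Finite U] (D : ModularTensor.Grading C U)
    (hD : D.IsUniversal) :
    (∀ g : U, (∃ X : C, D.comp g X ∧ ModularTensor.IsInvertibleObj X) →
      ModularTensor.rank (D.comp g) =
        ModularTensor.rank (ModularTensor.adjointSubcategory C)) ∧
    (∀ g h : U, (∃ X : C, D.comp g X ∧ ModularTensor.IsInvertibleObj X) →
      (∃ Y : C, D.comp h Y ∧ ModularTensor.IsInvertibleObj Y) →
      ModularTensor.rank (D.comp g) = ModularTensor.rank (D.comp h)) := by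
  have := ModularTensor.IsFusionCategory.finite_irr (k := k) (C := C)
  have key (g : U) : (∃ X : C, D.comp g X ∧ ModularTensor.IsInvertibleObj X) →
      ModularTensor.rank (D.comp g) =
        ModularTensor.rank (ModularTensor.adjointSubcategory C) := by
    rintro ⟨X, hX, h⟩
    rw [D.rank_comp_eq_of_isInvertibleObj hX h, hD.comp_one_eq k]
  exact ⟨key, fun g h hg hh => (key g hg).trans (key h hh).symm⟩
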